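/- Let $\mathbf{U}$ and $\mathbf{U}^+$ be Grothendieck universes containing $\omega$, with $\mathbf{U} \in \mathbf{U}^+$, let $\kappa$ be a regular (infinite) cardinal in $\mathbf{U}$, and let $\mu = |\mathbf{U}|$. For a universe $\mathbf{V}$, a regular cardinal $\lambda \in \mathbf{V}$ and a locally $\mathbf{V}$-small category $\mathcal{C}$, let $\mathrm{Ind}^{\mathbf{V}}_\lambda(\mathcal{C})$ be the free ind-completion of $\mathcal{C}$: its objects are the $\lambda$-filtered diagrams $X : \mathbb{D} \to \mathcal{C}$ with $\mathbb{D}$ a $\mathbf{V}$-small category, its morphisms are $\mathrm{Hom}(X, Y) = \varprojlim_i \varinjlim_j \mathcal{C}(X_i, Y_j)$, and $\gamma : \mathcal{C} \to \mathrm{Ind}^{\mathbf{V}}_\lambda(\mathcal{C})$ is the embedding that sends an object to the corresponding one-object diagram. A functor is $(\lambda, \mathbf{V})$-accessible if its domain is a $\lambda$-accessible $\mathbf{V}$-category and it preserves colimits of $\mathbf{V}$-small $\lambda$-filtered diagrams. Let $\mathbb{B}$ be a $\mathbf{U}$-small category that has colimits of all $\kappa$-small diagrams. Let $i : \mathrm{Ind}^{\mathbf{U}}_\kappa(\mathbb{B})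 \to \mathrm{Ind}^{\mathbf{U}^+}_\kappa(\mathbb{B})$ be the canonical functor, i.e. the (up to isomorphism unique) $(\kappa, \mathbf{U})$-accessible functor that extends the embedding $\gamma^+ : \mathbb{B} \to \mathrm{Ind}^{\mathbf{U}^+}_\kappa(\mathbb{B})$ along $\gamma : \mathbb{B} \to \mathrm{Ind}^{\mathbf{U}}_\kappa(\mathbb{B})$. Then the canonical functor $$\mathrm{Ind}^{\mathbf{U}^+}_\mu\bigl(\mathrm{Ind}^{\mathbf{U}}_\kappa(\mathbb{B})\bigr) \to \mathrm{Ind}^{\mathbf{U}^+}_\kappa(\mathbb{B}),$$ i.e. the (up to isomorphism unique) $(\mu, \mathbf{U}^+)$-accessible functor that extends $i$ along the embedding of $\mathrm{Ind}^{\mathbf{U}}_\kappa(\mathbb{B})$ into its ind-completion, is fully faithful and essentially surjective on objects. (Here the existence of both canonical functors is part of the assertion.) -/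

import Mathlib

open CategoryTheory CategoryTheory.Limits

universe w v u v' u'

/-- An object of the free ind-completion `Ind_κ(C)`: a `κ`-filtered diagram in `C`
indexed by a `w`-small category. -/
structure IndDiagram (κ : Cardinal.{w}) [Fact κ.IsRegular] (C : Type u) [Category.{v} C] where
  /-- The shape of the diagram. -/
  Index : Type w
  [category : SmallCategory Index]
  [filtered : IsCardinalFiltered Index κ]
  /-- The diagram itself. -/
  diagram : Index ⥤ C

namespace IndDiagram

attribute [instance] IndDiagram.category IndDiagram.filtered

variable {κ : Cardinal.{w}} [Fact κ.IsRegular] {C : Type u} [Category.{v} C]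

/-- The presheaf `colim_i C(-, X i)` presented by a diagram `X`. -/
noncomputable def presheaf (X : IndDiagram κ C) : Cᵒᵖ ⥤ Type (max w v) :=
  colimit (X.diagram ⋙ uliftYoneda.{w})

/-- Morphisms from `X` to `Y` in `Ind_κ(C)` are the morphisms of presheaves from
`colim_i C(-, X i)` to `colim_j C(-, Y j)`; by the Yoneda lemma they form the set
`lim_i colim_j C(X i, Y j)`. -/
noncomputable instance : Category.{max u v w} (IndDiagram κ C) :=
  inferInstanceAs (Category (InducedCategory (Cᵒᵖ ⥤ Type (max w v)) presheaf))

variable (κ) in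
/-- The one-object diagram with value `c`. -/
def single (c : C) : IndDiagram κ C :=
  haveI : IsCardinalFiltered (Discrete PUnit.{w + 1}) κ := isCardinalFiltered_of_hasTerminal _ κ
  { Index := Discrete PUnit.{w + 1}
    diagram := (Functor.const _).obj c }

/-- The map of presheaves presented by one-object diagrams that is induced by `f : c ⟶ d`. -/
noncomputable def singleMap {c d : C} (f : c ⟶ d) :
    colimit ((Functor.const (Discrete PUnit.{w + 1})).obj c ⋙ uliftYoneda.{w}) ⟶
      colimit ((Functor.const (Discrete PUnit.{w + 1})).obj d ⋙ uliftYoneda.{w}) :=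
  colimMap (Functor.whiskerRight ((Functor.const _).map f) uliftYoneda.{w})

theorem singleMap_id (c : C) : singleMap.{w} (𝟙 c) = 𝟙 _ := by
  apply colimit.hom_ext
  intro j
  simp [singleMap]

theorem singleMap_comp {c d e : C} (f : c ⟶ d) (g : d ⟶ e) :
    singleMap.{w} (f ≫ g) = singleMap.{w} f ≫ singleMap.{w} g := by
  apply colimit.hom_ext
  intro j
  simp [singleMap]

/-- The canonical embedding `γ : C ⥤ Ind_κ(C)`, sending an object to the one-object diagram
on it. -/
noncomputable def embedding (κ : Cardinal.{w}) [Fact κ.IsRegular] (C : Type u) [Category.{v} C] :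
    C ⥤ IndDiagram κ C where
  obj c := single κ c
  map {c d} f := InducedCategory.homMk (F := presheaf (κ := κ) (C := C))
    (X := single κ c) (Y := single κ d) (singleMap f)
  map_id c := InducedCategory.hom_ext (singleMap_id c)
  map_comp f g := InducedCategory.hom_ext (singleMap_comp f g)

end IndDiagram

/-- `F : C ⥤ D` is a `(κ, w)`-accessible functor: `C` is a `κ`-accessible category relative to the
universe `w`, and `F` preserves `w`-small `κ`-filtered colimits. -/
structure IsAccessibleFunctor (κ : Cardinal.{w}) [Fact κ.IsRegular]
    {C : Type u} [Category.{v} C] {D : Type u'} [Category.{v'} D] (F : C ⥤ D) : Prop where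
  accessible_domain : IsCardinalAccessibleCategory C κ
  preserves_filtered_colimits : F.IsCardinalAccessible κ

/-- `F' : Ind_κ(C) ⥤ D` is the accessible functor induced by `F : C ⥤ D`: it is accessible and
extends `F` along the canonical embedding `C ⥤ Ind_κ(C)`. -/
structure IsIndExtension (κ : Cardinal.{w}) [Fact κ.IsRegular]
    {C : Type u} [Category.{v} C] {D : Type u'} [Category.{v'} D]
    (F : C ⥤ D) (F' : IndDiagram κ C ⥤ D) : Prop where
  accessible : IsAccessibleFunctor κ F'
  extends_along_embedding : Nonempty (IndDiagram.embedding κ C ⋙ F' ≅ F)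

set_option linter.checkUnivs false in
/-- The cardinality of the universe of `u`-small sets, as a cardinal in the larger universe
`max (u + 1) w`. -/
noncomputable def universeCardinal : Cardinal.{max (u + 1) w} :=
  Cardinal.lift.{w} (Cardinal.mk ZFSet.{u})

theorem universeCardinal_eq_univ : universeCardinal.{w, u} = Cardinal.univ.{u, w} := by
  have key : Cardinal.mk ZFSet.{u} = Cardinal.univ.{u, u + 1} := by
    apply le_antisymm
    · have h1 : (⋃ o : Ordinal.{u}, {x : ZFSet.{u} | x ∈ ZFSet.vonNeumann o}) = Set.univ :=
        Set.eq_univ_of_forall fun x => Set.mem_iUnion.2 (ZFSet.exists_mem_vonNeumann x)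
      rw [← Cardinal.mk_univ, ← h1]
      refine (Cardinal.mk_iUnion_le _).trans ?_
      rw [Cardinal.mk_ordinal]
      refine (mul_le_mul_right (ciSup_le' fun o => ?_) _).trans
        (Cardinal.mul_eq_self Cardinal.aleph0_lt_univ.le).le
      exact ((ZFSet.vonNeumann o).cardinalMk_coe_sort.trans_lt (Cardinal.lift_lt_univ _)).le
    · rw [← Cardinal.mk_ordinal]
      exact Cardinal.mk_le_of_injective ZFSet.vonNeumann_injective
  rw [universeCardinal, key, Cardinal.lift_univ]
  exact Cardinal.univ_umax.{u, w}

instance universeCardinal_isRegular : Fact universeCardinal.{w, u}.IsRegular :=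
  ⟨universeCardinal_eq_univ ▸ Cardinal.IsInaccessible.univ.isRegular⟩

instance lift_isRegular (κ : Cardinal.{u}) [hκ : Fact κ.IsRegular] :
    Fact (Cardinal.lift.{w} κ).IsRegular :=
  ⟨hκ.out.lift⟩

/-! Write $A = \mathrm{Ind}^{\mathbf U}_\kappa(\mathbb B)$ and $D = \mathrm{Ind}^{\mathbf
U^+}_\kappa(\mathbb B)$. Ind-completions are studied inside presheaves: for a small base, the
ind-objects are the presheaves whose category of elements is `κ`-filtered, and these are closed
under `κ`-filtered colimits. Accessible extensions exist as pointwise left Kan extensions along the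
embedding.

Full faithfulness comes from one criterion, applied twice: the accessible extension of a fully
faithful functor with presentable values is fully faithful (`IsIndExtension.full`,
`IsIndExtension.faithful`). It applies to `i` because representables are `κ`-presentable in $D$. It
applies to the extension of `i` because every `i.obj X` is a $\mathbf U$-small colimit of
representables, and $\mathbf U$-small means of size less than $\mu$; hence `i.obj X` is
$\mu$-presentable.

For essential surjectivity, present an object of $D$ by a diagram in $\mathbb B$ over a `κ`-directed
poset `α`. The $\mathbf U$-small `κ`-directed subsets of `α` form a $\mu$-directed poset. The
diagram restricted to such a subset has a colimit in $A$, which `i` preserves, and the images of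
these colimits have the original object as their colimit
(`SmallDirectedSubset.exists_isColimit_colimitFunctor`). -/

open Opposite

universe w' t

/-! ### Filteredness and presentability under change of universe or cardinal. -/

section CardinalFiltered

/-- A preorder in which families of size `< κ` have upper bounds is `κ`-filtered. -/
theorem isCardinalFiltered_of_exists_upperBound {α : Type v} [Preorder α] (κ : Cardinal.{w})
    [Fact κ.IsRegular]
    (h : ∀ ⦃ι : Type w⦄ (s : ι → α), HasCardinalLT ι κ → ∃ a, ∀ i, s i ≤ a) :
    IsCardinalFiltered α κ where
  nonempty_cocone {A _ F hA} := by
    obtain ⟨a, ha⟩ := h F.obj (hasCardinalLT_of_hasCardinalLT_arrow hA)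
    exact ⟨Cocone.mk a { app i := homOfLE (ha i), naturality _ _ _ := rfl }⟩

/-- Being `κ`-filtered does not depend on the universe in which `κ` is considered. -/
theorem isCardinalFiltered_lift_iff (J : Type u) [Category.{v} J] (κ : Cardinal.{w})
    [Fact κ.IsRegular] :
    IsCardinalFiltered J (Cardinal.lift.{w'} κ) ↔ IsCardinalFiltered J κ := by
  refine ⟨fun _ ↦ ⟨fun {A _} F hA ↦ ⟨?_⟩⟩, fun _ ↦ ⟨fun {A _} F hA ↦ ⟨?_⟩⟩⟩
  · exact IsCardinalFiltered.cocone (κ := Cardinal.lift.{w'} κ) F (by simpa using hA)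
  · exact IsCardinalFiltered.cocone (κ := κ) F (by simpa using hA)

theorem HasCardinalFilteredColimits.of_le {C : Type u} [Category.{v} C] {κ κ' : Cardinal.{w}}
    [Fact κ.IsRegular] [Fact κ'.IsRegular] [HasCardinalFilteredColimits C κ] (h : κ ≤ κ') :
    HasCardinalFilteredColimits C κ' where
  hasColimitsOfShape J _ _ :=
    have := IsCardinalFiltered.of_le J h
    HasCardinalFilteredColimits.hasColimitsOfShape C κ J

theorem HasCardinalFilteredColimits.hasColimitsOfShape_of_essentiallySmall
    (C : Type u) [Category.{v} C] (κ : Cardinal.{w})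
    [Fact κ.IsRegular] [HasCardinalFilteredColimits C κ] (J : Type u') [Category.{v'} J]
    [EssentiallySmall.{w} J] [IsCardinalFiltered J κ] : HasColimitsOfShape J C := by
  have := IsCardinalFiltered.of_equivalence κ (equivSmallModel.{w} J)
  have := HasCardinalFilteredColimits.hasColimitsOfShape C κ (SmallModel.{w} J)
  exact hasColimitsOfShape_of_equivalence (equivSmallModel.{w} J).symm

theorem essentiallySmall_of_univLE (J : Type u) [Category.{v} J] [UnivLE.{u, w}] [UnivLE.{v, w}] :
    EssentiallySmall.{w} J :=
  have : LocallySmall.{w} J := ⟨fun _ _ ↦ UnivLE.small _⟩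
  essentiallySmall_of_small_of_locallySmall J

theorem HasCardinalFilteredColimits.of_lift {C : Type u} [Category.{v} C] {κ : Cardinal.{w}}
    [Fact κ.IsRegular] [HasCardinalFilteredColimits C (Cardinal.lift.{w'} κ)] :
    HasCardinalFilteredColimits C κ where
  hasColimitsOfShape J _ _ :=
    have : IsCardinalFiltered J (Cardinal.lift.{w'} κ) :=
      (isCardinalFiltered_lift_iff J κ).2 inferInstance
    have := essentiallySmall_of_univLE.{max w w'} J
    HasCardinalFilteredColimits.hasColimitsOfShape_of_essentiallySmall C (Cardinal.lift.{w'} κ) J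

theorem isCardinalPresentable_of_lift {C : Type u} [Category.{v} C] (κ : Cardinal.{w})
    [Fact κ.IsRegular] (X : C) [IsCardinalPresentable X (Cardinal.lift.{w'} κ)] :
    IsCardinalPresentable X κ where
  preservesColimitOfShape J _ _ :=
    have : IsCardinalFiltered J (Cardinal.lift.{w'} κ) :=
      (isCardinalFiltered_lift_iff J κ).2 inferInstance
    have := essentiallySmall_of_univLE.{max w w'} J
    preservesColimitsOfShape_of_isCardinalPresentable_of_essentiallySmall X
      (Cardinal.lift.{w'} κ) J

/-- Presentability is reflected by fully faithful accessible functors. -/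
theorem isCardinalPresentable_of_fullyFaithful {C : Type u} [Category.{v} C] {D : Type u'}
    [Category.{v'} D] (κ : Cardinal.{w}) [Fact κ.IsRegular] {F : C ⥤ D} (hF : F.FullyFaithful)
    [F.IsCardinalAccessible κ] (X : C) [IsCardinalPresentable (F.obj X) κ] :
    IsCardinalPresentable X κ := by
  rw [isCardinalPresentable_iff_isCardinalAccessible_uliftCoyoneda_obj.{v'}]
  -- The hom-sets of `C` and `D` may lie in different universes, hence the lifts on both sides.
  let e : F ⋙ uliftCoyoneda.{v}.obj (op (F.obj X)) ≅ uliftCoyoneda.{v'}.obj (op X) :=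
    NatIso.ofComponents (fun Y ↦ Equiv.toIso
      ((Equiv.ulift.trans hF.homEquiv.symm).trans Equiv.ulift.symm))
      (fun f ↦ by
        ext ⟨g⟩
        apply ULift.down_injective
        apply hF.map_injective
        simp [uliftCoyoneda, Equiv.ulift])
  exact Functor.isCardinalAccessible_of_natIso e κ

/-- Every small subset of a `κ`-directed preorder is contained in a small `κ`-directed subset. -/
theorem exists_small_isCardinalFiltered_superset {α : Type v} [Preorder α] (κ : Cardinal.{w})
    [Fact κ.IsRegular] [IsCardinalFiltered α κ] (T : Set α) [Small.{w} T] :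
    ∃ S : Set α, T ⊆ S ∧ Small.{w} S ∧ IsCardinalFiltered S κ := by
  -- The closure of `T` under chosen upper bounds of families of size `< κ` is the set of values of
  -- well-founded trees: leaves are elements of `T`, and a node has a set of children indexed by a
  -- small subset of `κ.out`. The W-type of trees lives in `Type w`, so its range is small.
  let K := {s : Set κ.out // HasCardinalLT s κ}
  let β : Shrink.{w} T ⊕ K → Type w := Sum.elim (fun _ ↦ PEmpty) (fun s ↦ s.1)
  let e : (Σ a : Shrink.{w} T ⊕ K, β a → α) → α := fun
    | ⟨.inl t, _⟩ => ((equivShrink T).symm t).1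
    | ⟨.inr s, f⟩ => IsCardinalFiltered.max (κ := κ) f s.2
  refine ⟨Set.range (WType.elim α e), fun t ht ↦ ?_, inferInstance, ?_⟩
  · exact ⟨.mk (.inl (equivShrink T ⟨t, ht⟩)) PEmpty.elim, by simp [WType.elim, e]⟩
  · refine isCardinalFiltered_of_exists_upperBound κ fun ι s hι ↦ ?_
    choose x hx using fun i ↦ (s i).2
    -- Reindexing by a subset of `κ.out` turns the trees for the given family into the children of a
    -- single node.
    obtain ⟨φ⟩ : Nonempty (ι ↪ κ.out) := by
      rw [← Cardinal.le_def, Cardinal.mk_out]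
      exact ((hasCardinalLT_iff_cardinal_mk_lt _ _).1 hι).le
    let ψ : ι ≃ Set.range φ := Equiv.ofInjective φ φ.injective
    let k : K := ⟨Set.range φ, (hasCardinalLT_iff_of_equiv ψ κ).1 hι⟩
    refine ⟨⟨_, .mk (.inr k) (fun j ↦ x (ψ.symm j)), rfl⟩, fun i ↦ ?_⟩
    rw [← Subtype.coe_le_coe, ← hx]
    have := leOfHom (IsCardinalFiltered.toMax (κ := κ)
      (fun j : Set.range φ ↦ WType.elim α e (x (ψ.symm j))) k.2 (ψ i))
    rw [Equiv.symm_apply_apply] at this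
    exact this

/-- Translates the cardinal condition "less than $\mu$" into $\mathbf U$-smallness; every size
argument about $\mu$ goes through it. -/
theorem hasCardinalLT_universeCardinal_iff (X : Type v) :
    HasCardinalLT X universeCardinal.{w, u} ↔ Small.{u} X := by
  rw [universeCardinal_eq_univ, HasCardinalLT, Cardinal.small_iff_lift_mk_lt_univ,
    ← Cardinal.lift_lt.{max v (u + 1), w} (a := Cardinal.lift.{u + 1} (Cardinal.mk X))]
  simp only [Cardinal.lift_univ, Cardinal.lift_lift]
  rw [← Cardinal.univ_umax.{u, max w v}]

end CardinalFiltered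

/-! ### Presheaves with a filtered category of elements. -/

section Presheaf

variable {C : Type u} [Category.{v} C] (κ : Cardinal.{w}) [Fact κ.IsRegular]

/-- By Yoneda, maps out of a representable are evaluation at `c`, which preserves all colimits of
presheaves. -/
instance isCardinalPresentable_uliftYoneda_obj (c : C) :
    IsCardinalPresentable (uliftYoneda.{w}.obj c) κ where
  preservesColimitOfShape J _ _ := by
    let e : coyoneda.obj (op (uliftYoneda.{w}.obj c)) ≅
        (evaluation Cᵒᵖ (Type (max w v))).obj (op c) ⋙ uliftFunctor.{max u v w} :=
      NatIso.ofComponents (fun P ↦ Equiv.toIso (uliftYonedaEquiv.trans Equiv.ulift.symm))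
    exact preservesColimitsOfShape_of_natIso e.symm

/-- The category of elements of a `κ`-filtered colimit of presheaves is `κ`-filtered
if those of the presheaves in the diagram are. -/
theorem isCardinalFiltered_costructuredArrow_of_isColimit [UnivLE.{max u v w, w}]
    {J : Type w} [SmallCategory J] [IsCardinalFiltered J κ]
    {K : J ⥤ Cᵒᵖ ⥤ Type (max w v)} {c : Cocone K} (hc : IsColimit c)
    (hK : ∀ j, IsCardinalFiltered (CostructuredArrow uliftYoneda.{w} (K.obj j)) κ) :
    IsCardinalFiltered (CostructuredArrow uliftYoneda.{w} c.pt) κ where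
  nonempty_cocone {A _} G hA := by
    have : LocallySmall.{w} (Cᵒᵖ ⥤ Type (max w v)) := ⟨fun _ _ ↦ UnivLE.small _⟩
    have : EssentiallySmall.{w} J := essentiallySmallSelf J
    let H : A ⥤ Cᵒᵖ ⥤ Type (max w v) := (G ⋙ CostructuredArrow.proj _ _) ⋙ uliftYoneda.{w}
    let s : Cocone H :=
      { pt := c.pt
        ι :=
          { app a := (G.obj a).hom
            naturality _ _ f := (CostructuredArrow.w (G.map f)).trans (Category.comp_id _).symm } }
    have (a : A) : IsCardinalPresentable (H.obj a) κ :=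
      isCardinalPresentable_uliftYoneda_obj κ _
    -- A colimit of fewer than `κ` representables is `κ`-presentable, so the whole diagram of
    -- elements of `c.pt` lifts to elements of one `K.obj j`, where a cocone is available.
    have : IsCardinalPresentable (colimit H) κ :=
      isCardinalPresentable_of_isColimit _ (colimit.isColimit H) κ hA
    obtain ⟨j, f, hf⟩ := IsCardinalPresentable.exists_hom_of_isColimit κ hc (colimit.desc H s)
    have hf' (a : A) : (colimit.ι H a ≫ f) ≫ c.ι.app j = (G.obj a).hom := by
      rw [Category.assoc, hf, colimit.ι_desc]
    let G' : A ⥤ CostructuredArrow uliftYoneda.{w} (K.obj j) :=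
      { obj a := CostructuredArrow.mk (Y := (G.obj a).left) (colimit.ι H a ≫ f)
        map {a b} φ := CostructuredArrow.homMk (G.map φ).left
          ((colimit.w_assoc H φ f)) }
    let t := IsCardinalFiltered.cocone (κ := κ) G' hA
    exact ⟨
      { pt := (CostructuredArrow.map (c.ι.app j)).obj t.pt
        ι :=
          { app a := CostructuredArrow.homMk (t.ι.app a).left (by
              have := CostructuredArrow.w (t.ι.app a)
              dsimp [G'] at this ⊢
              rw [reassoc_of% this]
              exact hf' a)
            naturality a b φ := by
              ext
              have := congr_arg CommaMorphism.left (t.w φ)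
              dsimp [G'] at this ⊢
              exact (show (G.map φ).left ≫ (t.ι.app b).left = _ from this).trans
                (Category.comp_id _).symm } }⟩

end Presheaf

/-! ### Ind-objects as presheaves, and accessibility of the ind-completion. -/

namespace IndDiagram

variable {κ : Cardinal.{w}} [Fact κ.IsRegular] {C : Type u} [Category.{v} C]

variable (κ C) in
/-- The fully faithful functor from the ind-completion to presheaves. -/
noncomputable def toPresheaf : IndDiagram κ C ⥤ Cᵒᵖ ⥤ Type (max w v) :=
  inducedFunctor presheaf

variable (κ C) in
/-- The functor `toPresheaf` is fully faithful. -/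
noncomputable def fullyFaithfulToPresheaf : (toPresheaf κ C).FullyFaithful :=
  fullyFaithfulInducedFunctor presheaf

instance : (toPresheaf κ C).Full := (fullyFaithfulToPresheaf κ C).full
instance : (toPresheaf κ C).Faithful := (fullyFaithfulToPresheaf κ C).faithful

variable (κ C) in
/-- The composite of `embedding` and `toPresheaf` is the Yoneda embedding. -/
noncomputable def embeddingCompToPresheaf : uliftYoneda.{w} ≅ embedding κ C ⋙ toPresheaf κ C :=
  -- The only object of the one-point shape is terminal, so its coprojection is invertible.
  have h (c : C) : IsIso (colimit.ι ((Functor.const (Discrete PUnit.{w + 1})).obj c ⋙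
      uliftYoneda.{w}) ⟨⟨⟩⟩) :=
    isIso_ι_of_isTerminal (IsTerminal.ofUniqueHom (fun _ ↦ Discrete.eqToHom rfl)
      (fun _ _ ↦ Subsingleton.elim _ _)) _
  NatIso.ofComponents
    (fun c ↦ @asIso _ _ _ _ (colimit.ι ((Functor.const (Discrete PUnit.{w + 1})).obj c ⋙
      uliftYoneda.{w}) ⟨⟨⟩⟩) (h c))
    (fun f ↦ (ι_colimMap (Functor.whiskerRight ((Functor.const _).map f) uliftYoneda.{w})
      (Discrete.mk PUnit.unit)).symm)

variable (κ C) in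
/-- The canonical embedding of a category in its ind-completion is fully faithful. -/
noncomputable def fullyFaithfulEmbedding : (embedding κ C).FullyFaithful :=
  .ofCompFaithful (G := toPresheaf κ C)
    ((ULiftYoneda.fullyFaithful.{w} C).ofIso (embeddingCompToPresheaf κ C))

instance : (embedding κ C).Full := (fullyFaithfulEmbedding κ C).full
instance : (embedding κ C).Faithful := (fullyFaithfulEmbedding κ C).faithful

/-- The cocone that presents an object of the ind-completion as a filtered colimit of
objects in the image of the embedding. -/
noncomputable def cocone (X : IndDiagram κ C) : Cocone (X.diagram ⋙ embedding κ C) where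
  pt := X
  ι :=
    { app i := (toPresheaf κ C).preimage
        ((embeddingCompToPresheaf κ C).inv.app _ ≫ colimit.ι (X.diagram ⋙ uliftYoneda.{w}) i)
      naturality i j f := by
        apply (toPresheaf κ C).map_injective
        have h := (embeddingCompToPresheaf κ C).inv.naturality_assoc (X.diagram.map f)
          (colimit.ι (X.diagram ⋙ uliftYoneda.{w}) j)
        have h' := colimit.w (X.diagram ⋙ uliftYoneda.{w}) f
        dsimp at h h' ⊢
        rw [h'] at h
        simp only [Functor.map_comp, Functor.map_preimage, Category.comp_id]
        exact h }

/-- Objects of the ind-completion are filtered colimits of objects in the image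
of the embedding. -/
noncomputable def isColimitCocone (X : IndDiagram κ C) : IsColimit X.cocone := by
  apply isColimitOfReflects (toPresheaf κ C)
  let e : X.diagram ⋙ uliftYoneda.{w} ≅ (X.diagram ⋙ embedding κ C) ⋙ toPresheaf κ C :=
    Functor.isoWhiskerLeft X.diagram (embeddingCompToPresheaf κ C)
  refine (IsColimit.precomposeHomEquiv e _).1
    (IsColimit.ofIsoColimit (colimit.isColimit (X.diagram ⋙ uliftYoneda.{w}))
      (Cocone.ext (Iso.refl _) fun i ↦ ?_))
  simp only [e, cocone, Functor.isoWhiskerLeft_hom, Cocone.precompose_obj_ι, NatTrans.comp_app,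
    Functor.whiskerLeft_app, Functor.mapCocone_ι_app, Functor.map_preimage]
  exact (Category.comp_id _).trans
    (Iso.hom_inv_id_app_assoc (embeddingCompToPresheaf κ C) _ _).symm

end IndDiagram

namespace IndDiagram

variable {κ : Cardinal.{w}} [Fact κ.IsRegular] {C : Type u} [Category.{v} C]

theorem isCardinalFiltered_costructuredArrow_toPresheaf [UnivLE.{max u v w, w}]
    (X : IndDiagram κ C) :
    IsCardinalFiltered (CostructuredArrow uliftYoneda.{w} ((toPresheaf κ C).obj X)) κ :=
  isCardinalFiltered_costructuredArrow_of_isColimit κ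
    (colimit.isColimit (X.diagram ⋙ uliftYoneda.{w})) fun i ↦
      (CostructuredArrow.mkIdTerminal (S := uliftYoneda.{w})
        (Y := X.diagram.obj i)).isCardinalFiltered κ

theorem essentiallySmall_costructuredArrow_uliftYoneda [UnivLE.{max u v w, w}]
    (P : Cᵒᵖ ⥤ Type (max w v)) : EssentiallySmall.{w} (CostructuredArrow uliftYoneda.{w} P) := by
  have h (X : Type (max u v w)) : Small.{w} X := UnivLE.small X
  have : LocallySmall.{w} (CostructuredArrow uliftYoneda.{w} P) :=
    ⟨fun _ _ ↦ (small_congr Equiv.ulift.{max u w}).1 (h _)⟩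
  have : Small.{w} (CostructuredArrow uliftYoneda.{w} P) := h _
  exact essentiallySmall_of_small_of_locallySmall _

/-- A presheaf with a `κ`-filtered category of elements is presented by an ind-object. -/
theorem exists_iso_toPresheaf_obj [UnivLE.{max u v w, w}] (P : Cᵒᵖ ⥤ Type (max w v))
    [IsCardinalFiltered (CostructuredArrow uliftYoneda.{w} P) κ] :
    ∃ X : IndDiagram κ C, Nonempty ((toPresheaf κ C).obj X ≅ P) := by
  have := essentiallySmall_costructuredArrow_uliftYoneda P
  let e := equivSmallModel.{w} (CostructuredArrow uliftYoneda.{w} P)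
  have := IsCardinalFiltered.of_equivalence κ e
  -- The presheaf is the colimit of the representables over its category of elements, here replaced
  -- by a small model.
  exact ⟨{  Index := SmallModel.{w} (CostructuredArrow uliftYoneda.{w} P)
            diagram := e.inverse ⋙ CostructuredArrow.proj _ _ },
    ⟨(colimit.isColimit _).coconePointUniqueUpToIso
      ((Presheaf.isColimitTautologicalCocone' P).whiskerEquivalence e.symm)⟩⟩

section

variable [UnivLE.{max u v w, w}] (J : Type w) [SmallCategory J] [IsCardinalFiltered J κ]

/-- The functor `toPresheaf` creates `κ`-filtered colimits. -/
noncomputable instance createsColimitsOfShapeToPresheaf :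
    CreatesColimitsOfShape J (toPresheaf κ C) where
  CreatesColimit {K} :=
    have : IsCardinalFiltered (CostructuredArrow uliftYoneda.{w}
        (colimit (K ⋙ toPresheaf κ C))) κ :=
      isCardinalFiltered_costructuredArrow_of_isColimit κ (colimit.isColimit _) fun j ↦
        isCardinalFiltered_costructuredArrow_toPresheaf (K.obj j)
    have h := exists_iso_toPresheaf_obj (κ := κ) (colimit (K ⋙ toPresheaf κ C))
    createsColimitOfFullyFaithfulOfIso h.choose h.choose_spec.some

end

variable (κ C)

section

variable [UnivLE.{max u v w, w}]

instance hasCardinalFilteredColimits : HasCardinalFilteredColimits (IndDiagram κ C) κ where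
  hasColimitsOfShape _ _ _ := hasColimitsOfShape_of_hasColimitsOfShape_createsColimitsOfShape
    (toPresheaf κ C)

instance isCardinalAccessible_toPresheaf : (toPresheaf κ C).IsCardinalAccessible κ where

instance isCardinalPresentable_embedding_obj (c : C) :
    IsCardinalPresentable ((embedding κ C).obj c) κ :=
  have : IsCardinalPresentable ((toPresheaf κ C).obj ((embedding κ C).obj c)) κ :=
    isCardinalPresentable_of_iso ((embeddingCompToPresheaf κ C).app c) κ
  isCardinalPresentable_of_fullyFaithful κ (fullyFaithfulToPresheaf κ C) _

/-- The free ind-completion is an accessible category. -/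
instance isCardinalAccessibleCategory : IsCardinalAccessibleCategory (IndDiagram κ C) κ := by
  have : LocallySmall.{w} (IndDiagram κ C) := ⟨fun _ _ ↦ UnivLE.small _⟩
  have : Small.{w} C :=
    (small_congr Equiv.ulift.{max v w}).1 (UnivLE.small.{max u v w} (ULift.{max v w} C))
  have h : (ObjectProperty.ofObj (embedding κ C).obj).IsCardinalFilteredGenerator κ :=
    { le_isCardinalPresentable := by
        rintro _ ⟨c⟩
        exact isCardinalPresentable_embedding_obj κ C c
      exists_colimitsOfShape X := ⟨X.Index, inferInstance, inferInstance, ⟨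
        { diag := X.diagram ⋙ embedding κ C
          ι := X.cocone.ι
          isColimit := X.isColimitCocone
          prop_diag_obj i := ⟨X.diagram.obj i⟩ }⟩⟩ }
  have := h.hasCardinalFilteredGenerator
  constructor

end

end IndDiagram

/-! ### Existence of accessible extensions by Kan extension. -/

namespace IndDiagram

variable {κ : Cardinal.{w}} [Fact κ.IsRegular] {C : Type u} [Category.{v} C]

/-- The canonical map from an object in the diagram of an ind-object. -/
noncomputable def ι (X : IndDiagram κ C) (i : X.Index) :
    (embedding κ C).obj (X.diagram.obj i) ⟶ X :=
  X.cocone.ι.app i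

theorem map_ι (X : IndDiagram κ C) {i j : X.Index} (f : i ⟶ j) :
    (embedding κ C).map (X.diagram.map f) ≫ X.ι j = X.ι i :=
  X.cocone.w f

theorem hom_ext {X Y : IndDiagram κ C} {f g : X ⟶ Y} (h : ∀ i, X.ι i ≫ f = X.ι i ≫ g) : f = g :=
  X.isColimitCocone.hom_ext h

theorem exists_ι_comp_eq {X Y : IndDiagram κ C}
    (g : ∀ i, (embedding κ C).obj (X.diagram.obj i) ⟶ Y)
    (hg : ∀ {i j} (f : i ⟶ j), (embedding κ C).map (X.diagram.map f) ≫ g j = g i) :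
    ∃ f : X ⟶ Y, ∀ i, X.ι i ≫ f = g i :=
  ⟨X.isColimitCocone.desc
    { pt := Y
      ι := { app := g, naturality _ _ f := (hg f).trans (Category.comp_id _).symm } },
    fun i ↦ X.isColimitCocone.fac _ i⟩

/-- The comparison between the shape of an ind-object and the category of objects over it. -/
noncomputable def toCostructuredArrow (X : IndDiagram κ C) :
    X.Index ⥤ CostructuredArrow (embedding κ C) X where
  obj i := CostructuredArrow.mk (Y := X.diagram.obj i) (X.ι i)
  map f := CostructuredArrow.homMk (X.diagram.map f) (X.map_ι f)

variable [UnivLE.{max u v w, w}]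

theorem exists_map_comp_ι_eq {X : IndDiagram κ C} {c : C} (f : (embedding κ C).obj c ⟶ X) :
    ∃ (i : X.Index) (g : c ⟶ X.diagram.obj i), (embedding κ C).map g ≫ X.ι i = f := by
  have : EssentiallySmall.{w} X.Index := essentiallySmallSelf _
  obtain ⟨i, g, hg⟩ := IsCardinalPresentable.exists_hom_of_isColimit κ X.isColimitCocone f
  obtain ⟨g, rfl⟩ := (embedding κ C).map_surjective g
  exact ⟨i, g, hg⟩

theorem exists_comp_map_eq {X : IndDiagram κ C} {c : C} {i : X.Index} (f g : c ⟶ X.diagram.obj i)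
    (h : (embedding κ C).map f ≫ X.ι i = (embedding κ C).map g ≫ X.ι i) :
    ∃ (j : X.Index) (t : i ⟶ j), f ≫ X.diagram.map t = g ≫ X.diagram.map t := by
  have : EssentiallySmall.{w} X.Index := essentiallySmallSelf _
  obtain ⟨j, t, ht⟩ := IsCardinalPresentable.exists_eq_of_isColimit' κ X.isColimitCocone
    ((embedding κ C).map f) ((embedding κ C).map g) h
  exact ⟨j, t, (embedding κ C).map_injective (by simpa using ht)⟩

/-- Reduces the colimit defining the Kan extension at `X` to a filtered colimit over `X.Index`.
Finality holds because objects in the image of the embedding are `κ`-presentable. -/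
instance final_toCostructuredArrow (X : IndDiagram κ C) : X.toCostructuredArrow.Final := by
  have := isFiltered_of_isCardinalFiltered X.Index κ
  refine Functor.final_of_exists_of_isFiltered _ (fun d ↦ ?_) (fun {d i} s s' ↦ ?_)
  · obtain ⟨i, g, hg⟩ := exists_map_comp_ι_eq d.hom
    exact ⟨i, ⟨CostructuredArrow.homMk g hg⟩⟩
  · obtain ⟨j, t, ht⟩ := exists_comp_map_eq s.left s'.left
      ((CostructuredArrow.w s).trans (CostructuredArrow.w s').symm)
    refine ⟨j, t, ?_⟩
    ext
    exact ht

variable {D : Type u'} [Category.{v'} D]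

section

variable {F : C ⥤ D} {F' : IndDiagram κ C ⥤ D} {α : F ⟶ embedding κ C ⋙ F'}
  (hF' : (Functor.LeftExtension.mk F' α).IsPointwiseLeftKanExtension)

include hF'

omit [UnivLE.{max u v w, w}] in
theorem leftExtension_hom_ext {X : IndDiagram κ C} {d : D} {f g : F'.obj X ⟶ d}
    (h : ∀ (c : C) (x : (embedding κ C).obj c ⟶ X),
      α.app c ≫ F'.map x ≫ f = α.app c ≫ F'.map x ≫ g) : f = g :=
  (hF' X).hom_ext fun x ↦
    (Category.assoc _ _ _).trans ((h x.left x.hom).trans (Category.assoc _ _ _).symm)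

omit [UnivLE.{max u v w, w}] in
theorem exists_leftExtension_desc {X : IndDiagram κ C} {d : D}
    (f : ∀ {c : C} (_ : (embedding κ C).obj c ⟶ X), F.obj c ⟶ d)
    (hf : ∀ {c c' : C} (φ : c ⟶ c') (x : (embedding κ C).obj c' ⟶ X),
      F.map φ ≫ f x = f ((embedding κ C).map φ ≫ x)) :
    ∃ g : F'.obj X ⟶ d, ∀ {c : C} (x : (embedding κ C).obj c ⟶ X),
      α.app c ≫ F'.map x ≫ g = f x := by
  let s : Cocone (CostructuredArrow.proj (embedding κ C) X ⋙ F) :=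
    { pt := d
      ι :=
        { app x := f x.hom
          naturality x y φ := by
            refine (hf φ.left y.hom).trans (Eq.trans ?_ (Category.comp_id _).symm)
            rw [CostructuredArrow.w φ]
            rfl } }
  exact ⟨(hF' X).desc s, fun x ↦ (Category.assoc _ _ _).symm.trans
    ((hF' X).fac s (CostructuredArrow.mk x))⟩

/-- Pointwise left Kan extensions along the embedding preserve filtered colimits. -/
theorem isCardinalAccessible_of_isPointwiseLeftKanExtension : F'.IsCardinalAccessible κ where
  preservesColimitOfShape J _ _ := ⟨fun {K} ↦ ⟨fun {c} hc ↦ by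
    have : EssentiallySmall.{w} J := essentiallySmallSelf _
    -- Since `(embedding κ C).obj x` is presentable, its maps into the colimit factor through a
    -- stage, and `unique` shows that the choice of factorization does not matter.
    have factor {x : C} (f : (embedding κ C).obj x ⟶ c.pt) :=
      IsCardinalPresentable.exists_hom_of_isColimit κ hc f
    have unique (s : Cocone (K ⋙ F')) {x : C} {j j' : J} (f : (embedding κ C).obj x ⟶ K.obj j)
        (f' : (embedding κ C).obj x ⟶ K.obj j') (h : f ≫ c.ι.app j = f' ≫ c.ι.app j') :
        F'.map f ≫ s.ι.app j = F'.map f' ≫ s.ι.app j' := by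
      obtain ⟨k, u, v, huv⟩ := IsCardinalPresentable.exists_eq_of_isColimit κ hc f f' h
      have hu := s.w u
      have hv := s.w v
      dsimp at hu hv
      rw [← hu, ← hv, ← Functor.map_comp_assoc, ← Functor.map_comp_assoc, huv]
    have desc (s : Cocone (K ⋙ F')) :
        ∃ g : F'.obj c.pt ⟶ s.pt, ∀ j, F'.map (c.ι.app j) ≫ g = s.ι.app j := by
      choose j f hf using @factor
      obtain ⟨g, hg⟩ := exists_leftExtension_desc hF' (X := c.pt) (d := s.pt)
        (fun {x} y ↦ α.app x ≫ F'.map (f y) ≫ s.ι.app (j y)) (fun {x x'} φ y ↦ by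
          rw [α.naturality_assoc, Functor.comp_map, ← Functor.map_comp_assoc]
          congr 1
          apply unique
          rw [Category.assoc, hf, hf])
      refine ⟨g, fun i ↦ leftExtension_hom_ext hF' fun x y ↦ ?_⟩
      rw [← Functor.map_comp_assoc, hg]
      congr 1
      apply unique
      rw [hf]
    choose g hg using desc
    refine ⟨{ desc := g, fac := hg, uniq := fun s m hm ↦ leftExtension_hom_ext hF' fun x y ↦ ?_ }⟩
    obtain ⟨j, f, rfl⟩ := factor y
    have := (hm j).trans (hg s j).symm
    dsimp at this
    simp only [Functor.map_comp, Category.assoc, Functor.const_obj_obj]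
    rw [this]⟩⟩

end

/-- A functor to a category with filtered colimits has an accessible extension to the
ind-completion. -/
theorem exists_isIndExtension [HasCardinalFilteredColimits D κ] (F : C ⥤ D) :
    ∃ F' : IndDiagram κ C ⥤ D, IsIndExtension κ F F' := by
  have : (embedding κ C).HasPointwiseLeftKanExtension F := fun X ↦ by
    have := HasCardinalFilteredColimits.hasColimitsOfShape D κ X.Index
    exact Functor.Final.hasColimit_of_comp X.toCostructuredArrow
  have h := (embedding κ C).pointwiseLeftKanExtensionIsPointwiseLeftKanExtension F
  -- The unit is invertible because the embedding is fully faithful.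
  have : IsIso ((embedding κ C).pointwiseLeftKanExtensionUnit F) := h.isIso_hom
  exact ⟨_, ⟨inferInstance, isCardinalAccessible_of_isPointwiseLeftKanExtension h⟩,
    ⟨(asIso ((embedding κ C).pointwiseLeftKanExtensionUnit F)).symm⟩⟩

end IndDiagram

/-! ### Full faithfulness of accessible extensions. -/

namespace IsIndExtension

open IndDiagram

variable {κ : Cardinal.{w}} [Fact κ.IsRegular] {C : Type u} [Category.{v} C]
  {D : Type u'} [Category.{v'} D] {F : C ⥤ D} {F' : IndDiagram κ C ⥤ D}

/-- An accessible extension sends an ind-object to the colimit of its diagram. -/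
theorem nonempty_isColimit_mapCocone (h : IsIndExtension κ F F') (X : IndDiagram κ C) :
    Nonempty (IsColimit (F'.mapCocone X.cocone)) := by
  have := h.accessible.preserves_filtered_colimits
  have := F'.preservesColimitsOfShape_of_isCardinalAccessible κ X.Index
  exact ⟨isColimitOfPreserves F' X.isColimitCocone⟩

theorem hom_ext (h : IsIndExtension κ F F') {X : IndDiagram κ C} {d : D} {f g : F'.obj X ⟶ d}
    (hfg : ∀ i, F'.map (X.ι i) ≫ f = F'.map (X.ι i) ≫ g) : f = g :=
  (h.nonempty_isColimit_mapCocone X).some.hom_ext hfg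

section

variable [∀ c, IsCardinalPresentable (F.obj c) κ]

theorem isCardinalPresentable_obj_embedding_obj (h : IsIndExtension κ F F') (c : C) :
    IsCardinalPresentable (F'.obj ((embedding κ C).obj c)) κ :=
  isCardinalPresentable_of_iso (h.extends_along_embedding.some.app c).symm κ

theorem exists_comp_map_ι_eq (h : IsIndExtension κ F F') {c : C} {Y : IndDiagram κ C}
    (f : F'.obj ((embedding κ C).obj c) ⟶ F'.obj Y) :
    ∃ (i : Y.Index) (g : F'.obj ((embedding κ C).obj c) ⟶
      F'.obj ((embedding κ C).obj (Y.diagram.obj i))), g ≫ F'.map (Y.ι i) = f := by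
  have : EssentiallySmall.{w} Y.Index := essentiallySmallSelf _
  have := h.isCardinalPresentable_obj_embedding_obj c
  exact IsCardinalPresentable.exists_hom_of_isColimit κ (h.nonempty_isColimit_mapCocone Y).some f

theorem exists_comp_map_map_eq (h : IsIndExtension κ F F') {c : C} {Y : IndDiagram κ C}
    {i j : Y.Index}
    (f : F'.obj ((embedding κ C).obj c) ⟶ F'.obj ((embedding κ C).obj (Y.diagram.obj i)))
    (g : F'.obj ((embedding κ C).obj c) ⟶ F'.obj ((embedding κ C).obj (Y.diagram.obj j)))
    (hfg : f ≫ F'.map (Y.ι i) = g ≫ F'.map (Y.ι j)) :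
    ∃ (k : Y.Index) (s : i ⟶ k) (t : j ⟶ k),
      f ≫ F'.map ((embedding κ C).map (Y.diagram.map s)) =
        g ≫ F'.map ((embedding κ C).map (Y.diagram.map t)) := by
  have : EssentiallySmall.{w} Y.Index := essentiallySmallSelf _
  have := h.isCardinalPresentable_obj_embedding_obj c
  exact IsCardinalPresentable.exists_eq_of_isColimit κ (h.nonempty_isColimit_mapCocone Y).some
    f g hfg

end

variable [UnivLE.{max u v w, w}] [F.Full] [F.Faithful] [∀ c, IsCardinalPresentable (F.obj c) κ]

/-- Both hom-sets are the filtered colimit over `j` of the maps from `c` to `Y.diagram.obj j`: the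
source by presentability in the ind-completion, the target by presentability of `F.obj c` and full
faithfulness of `F`. General sources follow because `X` and `F'.obj X` are colimits over `X.Index`.
-/
theorem bijective_map_embedding_obj (h : IsIndExtension κ F F') (c : C) (Y : IndDiagram κ C) :
    Function.Bijective (F'.map : ((embedding κ C).obj c ⟶ Y) → _) := by
  obtain ⟨e⟩ := h.extends_along_embedding
  have : (embedding κ C ⋙ F').Full := Functor.Full.of_iso e.symm
  have : (embedding κ C ⋙ F').Faithful := Functor.Faithful.of_iso e.symm
  refine ⟨fun f g hfg ↦ ?_, fun f ↦ ?_⟩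
  · obtain ⟨i, f, rfl⟩ := exists_map_comp_ι_eq f
    obtain ⟨j, g, rfl⟩ := exists_map_comp_ι_eq g
    rw [Functor.map_comp, Functor.map_comp] at hfg
    obtain ⟨k, s, t, hst⟩ := h.exists_comp_map_map_eq _ _ hfg
    have : f ≫ Y.diagram.map s = g ≫ Y.diagram.map t :=
      (embedding κ C ⋙ F').map_injective (by simpa using hst)
    rw [← Y.map_ι s, ← Y.map_ι t, ← Functor.map_comp_assoc, ← Functor.map_comp_assoc, this]
  · obtain ⟨i, f, rfl⟩ := h.exists_comp_map_ι_eq f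
    obtain ⟨f, rfl⟩ := (embedding κ C ⋙ F').map_surjective f
    exact ⟨(embedding κ C).map f ≫ Y.ι i, by simp⟩

/-- The accessible extension of a fully faithful functor with presentable values is faithful. -/
theorem faithful (h : IsIndExtension κ F F') : F'.Faithful where
  map_injective {X Y} f g hfg := IndDiagram.hom_ext fun i ↦
    (h.bijective_map_embedding_obj _ _).1 (by rw [Functor.map_comp, Functor.map_comp, hfg])

/-- The accessible extension of a fully faithful functor with presentable values is full. -/
theorem full (h : IsIndExtension κ F F') : F'.Full where
  map_surjective {X Y} f := by
    have := h.faithful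
    choose g hg using fun i ↦ (h.bijective_map_embedding_obj (X.diagram.obj i) Y).2
      (F'.map (X.ι i) ≫ f)
    obtain ⟨f', hf'⟩ := exists_ι_comp_eq g fun {i j} φ ↦ F'.map_injective (by
      rw [Functor.map_comp, hg, ← Functor.map_comp_assoc, map_ι, hg])
    exact ⟨f', h.hom_ext fun i ↦ by rw [← Functor.map_comp, hf', hg]⟩

end IsIndExtension

/-! ### Colimits over small directed subsets. -/

/-- The small `κ`-directed subsets of a preorder. -/
abbrev SmallDirectedSubset (α : Type t) [Preorder α] (κ : Cardinal.{u}) [Fact κ.IsRegular] :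
    Type t :=
  {S : Set α // Small.{u} S ∧ IsCardinalFiltered S κ}

namespace SmallDirectedSubset

variable {α : Type t} [Preorder α] {κ : Cardinal.{u}} [Fact κ.IsRegular]

/-- The underlying type of a small `κ`-directed subset. -/
abbrev Elem (S : SmallDirectedSubset α κ) : Type t := S.1

instance (S : SmallDirectedSubset α κ) : Small.{u} S.Elem := S.2.1

instance (S : SmallDirectedSubset α κ) : IsCardinalFiltered S.Elem κ := S.2.2

instance (S : SmallDirectedSubset α κ) : EssentiallySmall.{u} S.Elem :=
  have : LocallySmall.{u} S.Elem := ⟨fun _ _ ↦ small_subsingleton _⟩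
  essentiallySmall_of_small_of_locallySmall _

variable (α κ) in
-- A family of fewer than $\mu$ small subsets has a small union, which is contained in a small
-- `κ`-directed subset.
theorem isCardinalFiltered_universeCardinal [IsCardinalFiltered α κ] :
    IsCardinalFiltered (SmallDirectedSubset α κ) universeCardinal.{w, u} := by
  refine isCardinalFiltered_of_exists_upperBound _ fun K s hK ↦ ?_
  rw [hasCardinalLT_universeCardinal_iff] at hK
  have (k : K) : Small.{u} (s k).1 := (s k).2.1
  obtain ⟨S, hS, hS'⟩ := exists_small_isCardinalFiltered_superset κ (⋃ k, (s k).1)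
  exact ⟨⟨S, hS'⟩, fun k ↦ (Set.subset_iUnion (fun k ↦ (s k).1) k).trans hS⟩

theorem exists_mem [IsCardinalFiltered α κ] (a : α) : ∃ S : SmallDirectedSubset α κ, a ∈ S.1 := by
  obtain ⟨S, hS, hS'⟩ := exists_small_isCardinalFiltered_superset κ {a}
  exact ⟨⟨S, hS'⟩, hS rfl⟩

/-- The inclusion of a small directed subset. -/
def incl (S : SmallDirectedSubset α κ) : S.Elem ⥤ α :=
  Monotone.functor (f := fun a : S.Elem ↦ a.1) fun _ _ h ↦ h

variable {A : Type u'} [Category.{v'} A] [HasCardinalFilteredColimits A κ] (p : α ⥤ A)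

instance (S : SmallDirectedSubset α κ) : HasColimit (S.incl ⋙ p) :=
  have := HasCardinalFilteredColimits.hasColimitsOfShape_of_essentiallySmall A κ S.Elem
  inferInstance

/-- The canonical map from a value of a diagram to its colimit over a small directed subset. -/
noncomputable def ι (S : SmallDirectedSubset α κ) {a : α} (ha : a ∈ S.1) :
    p.obj a ⟶ colimit (S.incl ⋙ p) :=
  colimit.ι (S.incl ⋙ p) ⟨a, ha⟩

theorem map_ι (S : SmallDirectedSubset α κ) {a b : α} (ha : a ∈ S.1) (hb : b ∈ S.1)
    (f : a ⟶ b) : p.map f ≫ S.ι p hb = S.ι p ha :=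
  colimit.w (S.incl ⋙ p) (show (⟨a, ha⟩ : S.Elem) ⟶ ⟨b, hb⟩ from homOfLE (leOfHom f))

variable {p} in
theorem hom_ext {S : SmallDirectedSubset α κ} {X : A} {f g : colimit (S.incl ⋙ p) ⟶ X}
    (h : ∀ {a} (ha : a ∈ S.1), S.ι p ha ≫ f = S.ι p ha ≫ g) : f = g :=
  colimit.hom_ext fun a ↦ h a.2

/-- The map between colimits over small directed subsets that is induced by an inclusion. -/
noncomputable def map {S T : SmallDirectedSubset α κ} (h : S ≤ T) :
    colimit (S.incl ⋙ p) ⟶ colimit (T.incl ⋙ p) :=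
  colimit.desc (S.incl ⋙ p)
    { pt := _
      ι :=
        { app a := T.ι p (h a.2)
          naturality _ _ _ := (T.map_ι p _ _ _).trans (Category.comp_id _).symm } }

theorem ι_map {S T : SmallDirectedSubset α κ} (h : S ≤ T) {a : α} (ha : a ∈ S.1) :
    S.ι p ha ≫ map p h = T.ι p (h ha) :=
  colimit.ι_desc _ _

/-- The diagram of colimits over small directed subsets. -/
noncomputable def colimitFunctor : SmallDirectedSubset α κ ⥤ A where
  obj S := colimit (S.incl ⋙ p)
  map h := map p (leOfHom h)
  map_id S := hom_ext fun ha ↦ by rw [ι_map, Category.comp_id]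
  map_comp f g := hom_ext fun ha ↦ by rw [ι_map, ← Category.assoc, ι_map, ι_map]

section

variable {D : Type*} [Category* D] (i : A ⥤ D) [i.IsCardinalAccessible κ]

theorem map_hom_ext {S : SmallDirectedSubset α κ} {d : D} {f g : i.obj (colimit (S.incl ⋙ p)) ⟶ d}
    (h : ∀ {a} (ha : a ∈ S.1), i.map (S.ι p ha) ≫ f = i.map (S.ι p ha) ≫ g) : f = g :=
  have := i.preservesColimitsOfShape_of_isCardinalAccessible_of_essentiallySmall κ S.Elem
  (isColimitOfPreserves i (colimit.isColimit (S.incl ⋙ p))).hom_ext fun a ↦ h a.2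

theorem exists_map_desc (S : SmallDirectedSubset α κ) (c : Cocone (p ⋙ i)) :
    ∃ f : i.obj (colimit (S.incl ⋙ p)) ⟶ c.pt,
      ∀ {a} (ha : a ∈ S.1), i.map (S.ι p ha) ≫ f = c.ι.app a :=
  have := i.preservesColimitsOfShape_of_isCardinalAccessible_of_essentiallySmall κ S.Elem
  let h := isColimitOfPreserves i (colimit.isColimit (S.incl ⋙ p))
  ⟨h.desc (c.whisker S.incl), fun {a} ha ↦ h.fac (c.whisker S.incl) ⟨a, ha⟩⟩

/-- The colimit of a directed diagram is the colimit of its colimits over small directed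
subsets. -/
theorem exists_isColimit_colimitFunctor [IsCardinalFiltered α κ] {c : Cocone (p ⋙ i)}
    (hc : IsColimit c) :
    ∃ c' : Cocone (colimitFunctor (κ := κ) p ⋙ i), c'.pt = c.pt ∧ Nonempty (IsColimit c') := by
  choose f hf using fun S : SmallDirectedSubset α κ ↦ exists_map_desc p i S c
  let c' : Cocone (colimitFunctor (κ := κ) p ⋙ i) :=
    { pt := c.pt
      ι :=
        { app := f
          naturality S T h := map_hom_ext p i fun ha ↦ by
            dsimp [colimitFunctor]
            rw [← Functor.map_comp_assoc, ι_map, hf, Category.comp_id, hf] } }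
  have desc (s : Cocone (colimitFunctor (κ := κ) p ⋙ i)) :
      ∃ g : c.pt ⟶ s.pt, ∀ S, f S ≫ g = s.ι.app S := by
    have := isCardinalFiltered_universeCardinal.{0} α κ
    have := isFiltered_of_isCardinalFiltered (SmallDirectedSubset α κ) universeCardinal.{0, u}
    -- The map out of the value at `a` does not depend on the subset containing `a`, since two
    -- subsets lie in a common one.
    have key {a : α} {S T : SmallDirectedSubset α κ} (hS : a ∈ S.1) (hT : a ∈ T.1) :
        i.map (S.ι p hS) ≫ s.ι.app S = i.map (T.ι p hT) ≫ s.ι.app T := by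
      let U := IsFiltered.max S T
      have h₁ := s.w (IsFiltered.leftToMax S T)
      have h₂ := s.w (IsFiltered.rightToMax S T)
      dsimp [colimitFunctor] at h₁ h₂
      rw [← h₁, ← h₂, ← Functor.map_comp_assoc, ← Functor.map_comp_assoc, ι_map, ι_map]
    choose T hT using exists_mem (α := α) (κ := κ)
    let s' : Cocone (p ⋙ i) :=
      { pt := s.pt
        ι :=
          { app a := i.map ((T a).ι p (hT a)) ≫ s.ι.app (T a)
            naturality a b φ := by
              obtain ⟨S, ha, hb⟩ : ∃ S : SmallDirectedSubset α κ, a ∈ S.1 ∧ b ∈ S.1 :=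
                ⟨IsFiltered.max (T a) (T b), leOfHom (IsFiltered.leftToMax (T a) (T b)) (hT a),
                  leOfHom (IsFiltered.rightToMax (T a) (T b)) (hT b)⟩
              dsimp
              rw [key (hT a) ha, key (hT b) hb, Category.comp_id, ← S.map_ι p ha hb φ,
                Functor.map_comp]
              exact (Category.assoc _ _ _).symm } }
    refine ⟨hc.desc s', fun S ↦ map_hom_ext p i fun {a} ha ↦ ?_⟩
    rw [← Category.assoc, hf, hc.fac]
    exact key _ _
  choose g hg using desc
  refine ⟨c', rfl, ⟨{ desc := g, fac := hg, uniq := fun s m hm ↦ hc.hom_ext fun a ↦ ?_ }⟩⟩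
  obtain ⟨S, hS⟩ := exists_mem (κ := κ) a
  rw [← hf S hS, Category.assoc, Category.assoc, hg]
  congr 1
  exact hm S

end

end SmallDirectedSubset

/-! ### The canonical functors and the theorem. -/

open IndDiagram

theorem lift_le_universeCardinal (κ : Cardinal.{u}) :
    Cardinal.lift.{max (u + 1) w} κ ≤ universeCardinal.{w, u} := by
  rw [universeCardinal_eq_univ]
  exact (Cardinal.lift_lt_univ' κ).le

section

variable {κ : Cardinal.{u}} [Fact κ.IsRegular] {B : Type u} [SmallCategory B]
  {i : IndDiagram κ B ⥤ IndDiagram (Cardinal.lift.{max (u + 1) w} κ) B}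

/-- The canonical functor into the ind-completion relative to a larger universe is fully
faithful. -/
theorem IsIndExtension.fullyFaithful_of_lift
    (hi : IsIndExtension κ (embedding (Cardinal.lift.{max (u + 1) w} κ) B) i) :
    i.Full ∧ i.Faithful := by
  have (b : B) : IsCardinalPresentable ((embedding (Cardinal.lift.{max (u + 1) w} κ) B).obj b) κ :=
    isCardinalPresentable_of_lift.{_, _, _, max (u + 1) w} κ _
  exact ⟨hi.full, hi.faithful⟩

/-- The canonical functor into the ind-completion relative to a larger universe has
`|U|`-presentable values. -/
theorem IsIndExtension.isCardinalPresentable_of_lift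
    (hi : IsIndExtension κ (embedding (Cardinal.lift.{max (u + 1) w} κ) B) i)
    (X : IndDiagram κ B) :
    IsCardinalPresentable (i.obj X) universeCardinal.{w, u} := by
  obtain ⟨hX⟩ := hi.nonempty_isColimit_mapCocone X
  have : LocallySmall.{max (u + 1) w} (IndDiagram (Cardinal.lift.{max (u + 1) w} κ) B) :=
    ⟨fun _ _ ↦ inferInstance⟩
  have (j : X.Index) : IsCardinalPresentable (((X.diagram ⋙ embedding κ B) ⋙ i).obj j)
      universeCardinal.{w, u} :=
    have : IsCardinalPresentable (((X.diagram ⋙ embedding κ B) ⋙ i).obj j)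
        (Cardinal.lift.{max (u + 1) w} κ) :=
      hi.extends_along_embedding.elim fun e ↦
        isCardinalPresentable_of_iso (e.app (X.diagram.obj j)).symm _
    isCardinalPresentable_of_le _ (lift_le_universeCardinal κ)
  -- The shape of `X` is $\mathbf U$-small, so this is a colimit of fewer than $\mu$ objects that
  -- are $\mu$-presentable.
  exact isCardinalPresentable_of_isColimit _ hX universeCardinal.{w, u}
    ((hasCardinalLT_universeCardinal_iff.{w, u} (Arrow X.Index)).2 (small_self.{u} _))

/-- Every object of the ind-completion relative to a larger universe is a `|U|`-filtered colimit
of objects in the image of the ind-completion relative to the smaller one. -/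
theorem IsIndExtension.essSurj_of_lift
    (hi : IsIndExtension κ (embedding (Cardinal.lift.{max (u + 1) w} κ) B) i)
    {F : IndDiagram universeCardinal.{w, u} (IndDiagram κ B) ⥤
      IndDiagram (Cardinal.lift.{max (u + 1) w} κ) B}
    (hF : IsIndExtension universeCardinal.{w, u} i F) : F.EssSurj where
  mem_essImage d := by
    -- A final functor from a directed poset replaces the indexing category, so that one can speak
    -- of subsets of indices.
    obtain ⟨α, _, _, φ, _⟩ := IsCardinalFiltered.exists_cardinal_directed d.Index
      (Cardinal.lift.{max (u + 1) w} κ)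
    have : IsCardinalFiltered α κ :=
      (isCardinalFiltered_lift_iff.{_, _, _, max (u + 1) w} α κ).1 inferInstance
    have := hi.accessible.preserves_filtered_colimits
    obtain ⟨e⟩ := hi.extends_along_embedding
    obtain ⟨e'⟩ := hF.extends_along_embedding
    let p : α ⥤ IndDiagram κ B := (φ ⋙ d.diagram) ⋙ embedding κ B
    let e₁ : p ⋙ i ≅ φ ⋙ d.diagram ⋙ embedding (Cardinal.lift.{max (u + 1) w} κ) B :=
      Functor.isoWhiskerLeft (φ ⋙ d.diagram) e
    let c : Cocone (p ⋙ i) := (Cocone.precompose e₁.hom).obj (d.cocone.whisker φ)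
    have hc : IsColimit c := (IsColimit.precomposeHomEquiv e₁ _).symm
      ((Functor.Final.isColimitWhiskerEquiv φ _).symm d.isColimitCocone)
    obtain ⟨c', hc', ⟨h⟩⟩ := SmallDirectedSubset.exists_isColimit_colimitFunctor (κ := κ) p i hc
    have := SmallDirectedSubset.isCardinalFiltered_universeCardinal.{w} α κ
    let X : IndDiagram universeCardinal.{w, u} (IndDiagram κ B) :=
      { Index := SmallDirectedSubset α κ
        diagram := SmallDirectedSubset.colimitFunctor p }
    obtain ⟨hX⟩ := hF.nonempty_isColimit_mapCocone X
    exact ⟨X, ⟨hX.coconePointsIsoOfNatIso h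
      (Functor.isoWhiskerLeft (SmallDirectedSubset.colimitFunctor p) e') ≪≫ eqToIso hc'⟩⟩

end

theorem mainTheorem5 (κ : Cardinal.{u}) [Fact κ.IsRegular] (B : Type u) [SmallCategory B]
    (hB : ∀ (J : Type u) [SmallCategory J], HasCardinalLT (Arrow J) κ → HasColimitsOfShape J B) :
    (∃ i : IndDiagram κ B ⥤ IndDiagram (Cardinal.lift.{max (u + 1) w} κ) B,
      IsIndExtension κ (IndDiagram.embedding (Cardinal.lift.{max (u + 1) w} κ) B) i) ∧
    ∀ i : IndDiagram κ B ⥤ IndDiagram (Cardinal.lift.{max (u + 1) w} κ) B,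
      IsIndExtension κ (IndDiagram.embedding (Cardinal.lift.{max (u + 1) w} κ) B) i →
      (∃ F : IndDiagram universeCardinal.{w, u} (IndDiagram κ B) ⥤
          IndDiagram (Cardinal.lift.{max (u + 1) w} κ) B,
        IsIndExtension universeCardinal.{w, u} i F) ∧
      ∀ F : IndDiagram universeCardinal.{w, u} (IndDiagram κ B) ⥤
          IndDiagram (Cardinal.lift.{max (u + 1) w} κ) B,
        IsIndExtension universeCardinal.{w, u} i F → F.Full ∧ F.Faithful ∧ F.EssSurj := by
  -- The target has $\mathbf U^+$-small `κ`-filtered colimits. These include the $\mathbf U$-small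
  -- `κ`-filtered ones, needed to construct `i`, and the $\mathbf U^+$-small $\mu$-filtered ones,
  -- needed to extend `i`.
  have : HasCardinalFilteredColimits (IndDiagram (Cardinal.lift.{max (u + 1) w} κ) B) κ :=
    HasCardinalFilteredColimits.of_lift.{_, _, _, max (u + 1) w}
  have : HasCardinalFilteredColimits (IndDiagram (Cardinal.lift.{max (u + 1) w} κ) B)
      universeCardinal.{w, u} :=
    HasCardinalFilteredColimits.of_le (lift_le_universeCardinal κ)
  refine ⟨exists_isIndExtension.{u, u, u} _, fun i hi ↦
    ⟨exists_isIndExtension.{max (u + 1) w, u, u + 1} i, fun F hF ↦ ?_⟩⟩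
  have := hi.fullyFaithful_of_lift.1
  have := hi.fullyFaithful_of_lift.2
  have (X : IndDiagram κ B) := hi.isCardinalPresentable_of_lift X
  exact ⟨hF.full, hF.faithful, hi.essSurj_of_lift hF⟩
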